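/- Let target locations in $\mathbb{R}^2$ be the points of a homogeneous Poisson point process of intensity $\lambda>0$. The rewards $r(p)$ attached to the targets are i.i.d., independent of the locations, and Pareto distributed with scale $x_m>0$ and index $\alpha\in(0,2)$, i.e. $\mathbb{P}(r\le x)=1-(x_m/x)^\alpha$ for $x\ge x_m$ and $\mathbb{P}(r\le x)=0$ for $x<x_m$. A robot starts at the origin and moves according to $\dot x_1(t)=v$, $\dot x_2(t)=u(t)$, $|u(t)|\le v$, where $v>0$ is constant. For $L>0$ let $\Pi(L)$ be the set of its feasible paths on the time interval $[0,L/v]$ (those travelling a distance $L$ in the $x_1$-direction), and put $$T^*_2(L)=\sup_{\pi\in\Pi(L)}\ \sum_{p\in\pi} r(p),\qquad R^*_2(L)=\frac{T^*_2(L)}{L},\qquad \mathbf{R}^*_2=\sup_{L>0}\frac{\mathbb{E}\,T^*_2(L)}{L},$$ the inner sum being over the targets $p$ visited by $\pi$. Then the optimal mean reward is infinite: $$\mathbf{R}^*_2=\lim_{L\to\infty}\mathbb{E}[R^*_2(L)]=\infty .$$ Moreover, $T^*_2(L)$ is of order $L^{2/\alpha}$ and $R^*_2(L)$ is of order $L^{2/\alpha-1}$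 in probability as $L\to\infty$. That is, $T^*_2(L)=O(L^{2/\alpha})$ and $R^*_2(L)=O(L^{2/\alpha-1})$ in probability: for every $\varepsilon>0$ there are $C>0$ and $L_0$ such that for all $L\ge L_0$ $$\mathbb{P}\big(T^*_2(L)> C L^{2/\alpha}\big)\le\varepsilon,\qquad \mathbb{P}\big(R^*_2(L)> C L^{2/\alpha-1}\big)\le\varepsilon ,$$ and these orders are exact: for every $\varepsilon>0$ there are $c>0$ and $L_0$ such that for all $L\ge L_0$ $$\mathbb{P}\big(T^*_2(L)< c L^{2/\alpha}\big)\le\varepsilon,\qquad \mathbb{P}\big(R^*_2(L)< c L^{2/\alpha-1}\big)\le\varepsilon .$$ -/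

import Mathlib

open MeasureTheory ProbabilityTheory Filter Set Topology
open scoped ENNReal NNReal

namespace RewardField

noncomputable section

/-- The number of points of the random set `{p 0, p 1, …}` of the plane that lie in `A`, counted by
their index. -/
def count {Ω : Type*} (p : ℕ → Ω → ℝ × ℝ) (A : Set (ℝ × ℝ)) (ω : Ω) : ℕ∞ :=
  {i : ℕ | p i ω ∈ A}.encard

/-- The random set `{p 0, p 1, …}` is a homogeneous Poisson point process of intensity `lam` on the
plane: the number of points in a region `A` of finite area `|A|` is Poisson distributed with mean
`lam * |A|`, and the numbers of points in disjoint regions are independent. -/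
structure IsPoissonProcess {Ω : Type*} [MeasurableSpace Ω] (μ : Measure Ω) (lam : ℝ)
    (p : ℕ → Ω → ℝ × ℝ) : Prop where
  measurable : ∀ i, Measurable (p i)
  hasLaw_count : ∀ A : Set (ℝ × ℝ), MeasurableSet A → volume A < ∞ →
    HasLaw (count p A) ((poissonMeasure (lam * volume.real A).toNNReal).map (Nat.cast : ℕ → ℕ∞)) μ
  indep_count : ∀ (n : ℕ) (A : Fin n → Set (ℝ × ℝ)), (∀ j, MeasurableSet (A j)) →
    (∀ j, volume (A j) < ∞) → Pairwise (fun j k => Disjoint (A j) (A k)) →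
    iIndepFun (fun j => count p (A j)) μ

/-- A Poisson field of targets with i.i.d. rewards: the target locations `p i` form a Poisson
process of intensity `lam`, and the rewards `r i` attached to them are independent with common law
`F`, and independent of the locations. -/
structure IsPoissonRewardField {Ω : Type*} [MeasurableSpace Ω] (μ : Measure Ω) (lam : ℝ)
    (F : Measure ℝ) (p : ℕ → Ω → ℝ × ℝ) (r : ℕ → Ω → ℝ) : Prop where
  poisson : IsPoissonProcess μ lam p
  measurable_reward : ∀ i, Measurable (r i)
  hasLaw_reward : ∀ i, HasLaw (r i) F μ
  indep_reward : iIndepFun r μ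
  indep_location_reward : IndepFun (fun ω i => p i ω) (fun ω i => r i ω) μ

/-- `Π(L)`: the feasible paths of the robot that start at the origin and travel the distance `L` in
the longitudinal direction, that is, the (Carathéodory) solutions on the time interval
`[0, L / v]`, with `x(0) = 0`, of `ẋ₁ = v`, `ẋ₂ = u(t)` with a measurable control `|u(t)| ≤ v`. -/
def IsFeasiblePath (v L : ℝ) (x : ℝ → ℝ × ℝ) : Prop :=
  ∃ u : ℝ → ℝ, Measurable u ∧ (∀ t, |u t| ≤ v) ∧
    ∀ t ∈ Icc 0 (L / v), x t = (∫ _s in (0 : ℝ)..t, v, ∫ s in (0 : ℝ)..t, u s)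

/-- The indices of the targets visited by the path `x` during the time interval `[0, L / v]`. -/
def visited {Ω : Type*} (p : ℕ → Ω → ℝ × ℝ) (v L : ℝ) (x : ℝ → ℝ × ℝ) (ω : Ω) : Set ℕ :=
  {i | ∃ t ∈ Icc 0 (L / v), x t = p i ω}

/-- `T*₂(L)`: the optimal total reward collected along a path in `Π(L)`. -/
def optimalReward {Ω : Type*} (p : ℕ → Ω → ℝ × ℝ) (r : ℕ → Ω → ℝ) (v L : ℝ) (ω : Ω) : ℝ≥0∞ :=
  ⨆ (x : ℝ → ℝ × ℝ) (_ : IsFeasiblePath v L x), ∑' i : visited p v L x ω, ENNReal.ofReal (r i ω)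

/-- `R*₂(L) = T*₂(L) / L`: the optimal reward per unit of distance travelled. -/
def meanReward {Ω : Type*} (p : ℕ → Ω → ℝ × ℝ) (r : ℕ → Ω → ℝ) (v L : ℝ) (ω : Ω) : ℝ≥0∞ :=
  optimalReward p r v L ω / ENNReal.ofReal L

/-- `R*₂ = sup_{L > 0} E[T*₂(L)] / L`: the optimal mean reward. -/
def optimalMeanReward {Ω : Type*} [MeasurableSpace Ω] (μ : Measure Ω) (p : ℕ → Ω → ℝ × ℝ)
    (r : ℕ → Ω → ℝ) (v : ℝ) : ℝ≥0∞ :=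
  ⨆ (L : ℝ) (_ : 0 < L), (∫⁻ ω, optimalReward p r v L ω ∂μ) / ENNReal.ofReal L

/-- `X(L) = O(a(L))` in probability as `L → ∞`: for every `ε > 0` there is a constant `C` such that
`X(L) ≤ C * a(L)` outside an event of probability at most `ε`, for all large `L`. -/
def IsBigOInProbability {Ω : Type*} [MeasurableSpace Ω] (μ : Measure Ω) (X : ℝ → Ω → ℝ≥0∞)
    (a : ℝ → ℝ) : Prop :=
  ∀ ε : ℝ, 0 < ε → ∃ C : ℝ, 0 < C ∧
    ∀ᶠ L in atTop, μ {ω | ENNReal.ofReal (C * a L) < X L ω} ≤ ENNReal.ofReal ε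

/-- `X(L) = Ω(a(L))` in probability as `L → ∞`: for every `ε > 0` there is a constant `c > 0` such
that `c * a(L) ≤ X(L)` outside an event of probability at most `ε`, for all large `L`. -/
def IsBigOmegaInProbability {Ω : Type*} [MeasurableSpace Ω] (μ : Measure Ω) (X : ℝ → Ω → ℝ≥0∞)
    (a : ℝ → ℝ) : Prop :=
  ∀ ε : ℝ, 0 < ε → ∃ c : ℝ, 0 < c ∧
    ∀ᶠ L in atTop, μ {ω | X L ω < ENNReal.ofReal (c * a L)} ≤ ENNReal.ofReal ε

end

end RewardField

/-! Everything is governed by the largest reward within reach. The reachable region has area of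
order `L ^ 2`, and the Pareto tail at `L ^ (2 / α)` is of order `L ^ (-2)`, so about one reachable
target has a reward of that size.

Lower bound: a square inside the cone of slope one contains such a target with high probability
(`exists_event_le_optimalReward`), and one path collects it. Dividing by `L` leaves the exponent `2
/ α - 1 > 0`, hence infinite limiting mean.

Upper bound: with high probability no reachable reward exceeds `Y = K * L ^ (2 / α)`. Below `Y`,
rewards are split into dyadic layers (`tsum_reward_le`). The targets above a level `y` form a
thinned Poisson process, and a path meets on average at most order `n` of them, where `n ^ 2` bounds
`L ^ 2` times the tail at `y` (`exists_encard_visited_le`): every path lies in one of `3 ^ n`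
corridors of area at most `3 * L ^ 2 / n`, and a union bound on the exponential moments of the
counts beats this entropy. Layer `j` contributes order `Y * (2 ^ (α / 2) / 2) ^ j`, summable as `α <
2`; Markov's inequality concludes. -/

namespace RewardField

noncomputable section

/-! ### Generating functional of the marked Poisson process -/

section

theorem lintegral_pow_poissonMeasure (m : ℝ≥0) {g : ℝ} (hg : 0 ≤ g) :
    ∫⁻ k, ENNReal.ofReal g ^ k ∂(poissonMeasure m) = ENNReal.ofReal (Real.exp (m * (g - 1))) := by
  rw [lintegral_countable']
  have h := ((NormedSpace.expSeries_div_hasSum_exp (m * g : ℝ)).mul_left (Real.exp (-m)))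
  rw [← Real.exp_eq_exp_ℝ, ← Real.exp_add] at h
  rw [show (m : ℝ) * (g - 1) = -m + m * g by ring, ← h.tsum_eq,
    ENNReal.ofReal_tsum_of_nonneg (fun n => by positivity) h.summable]
  congr 1 with n
  rw [poissonMeasure_singleton, ← ENNReal.ofReal_pow hg, ← ENNReal.ofReal_mul (by positivity)]
  congr 1
  rw [mul_pow]
  ring

variable {Ω : Type*} {p : ℕ → Ω → ℝ × ℝ} {r : ℕ → Ω → ℝ} {A : Set (ℝ × ℝ)}

/-- The product of `g (r i)` over the targets `p i` in the region `A`, where it is finite. -/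
def markedProd (p : ℕ → Ω → ℝ × ℝ) (r : ℕ → Ω → ℝ) (A : Set (ℝ × ℝ)) (g : ℝ → ℝ≥0∞) (ω : Ω) :
    ℝ≥0∞ :=
  ∑' I : Finset ℕ, {ω | {i | p i ω ∈ A} = ↑I}.indicator (fun ω => ∏ i ∈ I, g (r i ω)) ω

theorem markedProd_eq_prod {g : ℝ → ℝ≥0∞} {ω : Ω} {I : Finset ℕ} (hI : {i | p i ω ∈ A} = ↑I) :
    markedProd p r A g ω = ∏ i ∈ I, g (r i ω) := by
  rw [markedProd, tsum_eq_single I]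
  · exact indicator_of_mem (s := {ω | {i | p i ω ∈ A} = ↑I}) hI _
  · intro J hJ
    refine indicator_of_notMem (s := {ω | {i | p i ω ∈ A} = ↑J}) (fun h => hJ ?_) _
    exact_mod_cast (h.symm.trans hI)

theorem measurableSet_index_eq (A : Set (ℝ × ℝ)) (hA : MeasurableSet A) (I : Finset ℕ) :
    MeasurableSet {x : ℕ → ℝ × ℝ | {i | x i ∈ A} = ↑I} := by
  have : {x : ℕ → ℝ × ℝ | {i | x i ∈ A} = ↑I} = ⋂ i, {x | x i ∈ A ↔ i ∈ I} := by
    ext x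
    simp [Set.ext_iff]
  rw [this]
  refine MeasurableSet.iInter fun i => ?_
  have hi : MeasurableSet {x : ℕ → ℝ × ℝ | x i ∈ A} := (measurable_pi_apply i) hA
  by_cases h : i ∈ I
  · simpa [h] using hi
  · have : {x : ℕ → ℝ × ℝ | x i ∈ A ↔ i ∈ I} = {x : ℕ → ℝ × ℝ | x i ∈ A}ᶜ := by
      ext x
      simp [h]
    exact this ▸ hi.compl

variable [MeasurableSpace Ω] {μ : Measure Ω} {lam : ℝ} {F : Measure ℝ}

theorem IsPoissonProcess.ae_finite (h : IsPoissonProcess μ lam p) (hA : MeasurableSet A)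
    (hA' : volume A < ∞) : ∀ᵐ ω ∂μ, {i | p i ω ∈ A}.Finite := by
  have h1 := (h.hasLaw_count A hA hA').ae_iff (p := fun n => n ≠ ⊤) (by fun_prop)
  have h2 : ∀ᵐ ω ∂μ, count p A ω ≠ ⊤ := by
    rw [h1, ae_map_iff (by fun_prop) (MeasurableSet.of_discrete)]
    simp
  filter_upwards [h2] with ω hω
  exact Set.encard_ne_top_iff.1 hω

theorem IsPoissonRewardField.measurable_markedProd (h : IsPoissonRewardField μ lam F p r)
    (hA : MeasurableSet A) {g : ℝ → ℝ≥0∞} (hg : Measurable g) :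
    Measurable (markedProd p r A g) := by
  refine Measurable.tsum fun I => Measurable.indicator ?_ ?_
  · exact Finset.measurable_fun_prod _ fun i _ => hg.comp (h.measurable_reward i)
  · exact (measurable_pi_lambda _ h.poisson.measurable) (measurableSet_index_eq A hA I)

/-- The generating functional of a marked Poisson process. -/
theorem IsPoissonRewardField.lintegral_markedProd (h : IsPoissonRewardField μ lam F p r)
    (hlam : 0 ≤ lam) (hA : MeasurableSet A) (hA' : volume A < ∞) {g : ℝ → ℝ≥0∞} (hg : Measurable g)
    {G : ℝ} (hG : 0 ≤ G) (hgG : ∫⁻ x, g x ∂F = ENNReal.ofReal G) :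
    ∫⁻ ω, markedProd p r A g ω ∂μ =
      ENNReal.ofReal (Real.exp (lam * volume.real A * (G - 1))) := by
  have hp : Measurable fun ω i => p i ω := measurable_pi_lambda _ h.poisson.measurable
  have hS : ∀ I : Finset ℕ, MeasurableSet {ω | {i | p i ω ∈ A} = ↑I} := fun I =>
    hp (measurableSet_index_eq A hA I)
  -- The event that `I` is the index set depends on the locations only, so independence lets each
  -- mark factor be replaced by its mean `G`.
  have hterm : ∀ I : Finset ℕ,
      ∫⁻ ω, {ω | {i | p i ω ∈ A} = ↑I}.indicator (fun ω => ∏ i ∈ I, g (r i ω)) ω ∂μ =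
        ∫⁻ ω, {ω | {i | p i ω ∈ A} = ↑I}.indicator (fun ω => ENNReal.ofReal G ^ I.card) ω ∂μ := by
    intro I
    have hprod : ∫⁻ ω, ∏ i ∈ I, g (r i ω) ∂μ = ENNReal.ofReal G ^ I.card := by
      rw [lintegral_prod_eq_prod_lintegral_of_indepFun I (fun i ω => g (r i ω))
        (h.indep_reward.comp (fun _ => g) (fun _ => hg)) (fun i => hg.comp (h.measurable_reward i))]
      rw [Finset.prod_congr rfl fun i _ => ((h.hasLaw_reward i).lintegral_comp hg.aemeasurable)]
      simp [hgG]
    have hφ : Measurable ({x : ℕ → ℝ × ℝ | {i | x i ∈ A} = ↑I}.indicator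
        (fun _ => (1 : ℝ≥0∞))) := measurable_const.indicator (measurableSet_index_eq A hA I)
    have hψ : Measurable (fun y : ℕ → ℝ => ∏ i ∈ I, g (y i)) :=
      Finset.measurable_fun_prod _ fun i _ => hg.comp (measurable_pi_apply i)
    have hind := h.indep_location_reward.comp hφ hψ
    have hmul := lintegral_mul_eq_lintegral_mul_lintegral_of_indepFun''
      (hφ.comp hp).aemeasurable
      ((Finset.measurable_fun_prod _ fun i _ => hg.comp (h.measurable_reward i)).aemeasurable) hind
    rw [lintegral_indicator_const (hS I)]
    calc _ = ∫⁻ ω, ({x : ℕ → ℝ × ℝ | {i | x i ∈ A} = ↑I}.indicator (fun _ => (1 : ℝ≥0∞))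
          ∘ fun ω i => p i ω) ω * ((fun y : ℕ → ℝ => ∏ i ∈ I, g (y i)) ∘ fun ω i => r i ω) ω ∂μ := by
            refine lintegral_congr fun ω => ?_
            by_cases hω : {i | p i ω ∈ A} = ↑I <;> simp [indicator, hω]
      _ = _ := by
        refine hmul.trans ?_
        rw [mul_comm]
        congr 1
        have : ({x : ℕ → ℝ × ℝ | {i | x i ∈ A} = ↑I}.indicator (fun _ => (1 : ℝ≥0∞))
          ∘ fun ω i => p i ω) = {ω | {i | p i ω ∈ A} = ↑I}.indicator (fun _ => (1 : ℝ≥0∞)) := by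
          ext ω
          simp [indicator]
        rw [this, lintegral_indicator_const (hS I), one_mul]
  -- Resummed over `I`, what remains is `G` to the power of the Poisson count.
  have hcount : ∀ᵐ ω ∂μ, ∑' I : Finset ℕ,
      {ω | {i | p i ω ∈ A} = ↑I}.indicator (fun ω => ENNReal.ofReal G ^ I.card) ω =
        ENNReal.ofReal G ^ (count p A ω).toNat := by
    filter_upwards [h.poisson.ae_finite hA hA'] with ω hω
    have hI : {i | p i ω ∈ A} = ↑hω.toFinset := by simp
    have := markedProd_eq_prod (r := r) (g := fun _ => ENNReal.ofReal G) hI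
    simp only [markedProd, Finset.prod_const] at this
    rw [this, count, hω.encard_eq_coe_toFinset_card, ENat.toNat_natCast]
  have hm : ∀ I : Finset ℕ, AEMeasurable ({ω | {i | p i ω ∈ A} = ↑I}.indicator
      (fun _ => ENNReal.ofReal G ^ I.card)) μ := fun I =>
    (measurable_const.indicator (hS I)).aemeasurable
  unfold markedProd
  have hm' : ∀ I : Finset ℕ, AEMeasurable ({ω | {i | p i ω ∈ A} = ↑I}.indicator
      (fun ω => ∏ i ∈ I, g (r i ω))) μ := fun I =>
    ((Finset.measurable_fun_prod _ fun i _ =>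
      hg.comp (h.measurable_reward i)).indicator (hS I)).aemeasurable
  rw [lintegral_tsum hm', tsum_congr hterm, ← lintegral_tsum hm, lintegral_congr_ae hcount,
    (h.poisson.hasLaw_count A hA hA').lintegral_comp (f := fun n => ENNReal.ofReal G ^ n.toNat)
      (by fun_prop), lintegral_map (by fun_prop) (by fun_prop)]
  simp only [ENat.toNat_natCast]
  rw [lintegral_pow_poissonMeasure _ hG, Real.coe_toNNReal _ (by positivity)]

end

/-! ### Pareto tails, exponential moments and the largest reward -/

section

theorem paretoMeasure_Ioi {t a y : ℝ} (ht : 0 < t) (ha : 0 < a) (hy : t ≤ y) :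
    paretoMeasure t a (Ioi y) = ENNReal.ofReal ((t / y) ^ a) := by
  have hy0 : 0 < y := ht.trans_le hy
  rw [paretoMeasure, withDensity_apply _ measurableSet_Ioi,
    setLIntegral_congr_fun (g := fun x => ENNReal.ofReal (a * t ^ a * x ^ (-(a + 1))))
      measurableSet_Ioi (fun x hx => paretoPDF_of_le (hy.trans (le_of_lt hx))),
    ← ofReal_integral_eq_lintegral_ofReal, integral_const_mul,
    integral_Ioi_rpow_of_lt (by linarith) hy0]
  · congr 1
    rw [Real.div_rpow ht.le hy0.le, show -(a + 1) + 1 = -a by ring, Real.rpow_neg hy0.le]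
    field_simp
  · exact (integrableOn_Ioi_rpow_of_lt (by linarith) hy0).const_mul _
  · rw [EventuallyLE, ae_restrict_iff' measurableSet_Ioi]
    filter_upwards with x hx
    have : 0 < x := hy0.trans hx
    positivity

/-- Below the scale `t` the right side is at least one. This range matters because the dyadic levels
eventually drop below the scale. -/
theorem paretoMeasure_Ioi_le {t a y : ℝ} (ht : 0 < t) (ha : 0 < a) (hy : 0 < y) :
    paretoMeasure t a (Ioi y) ≤ ENNReal.ofReal ((t / y) ^ a) := by
  rcases le_total t y with h | h
  · exact (paretoMeasure_Ioi ht ha h).le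
  · have := isProbabilityMeasure_paretoMeasure ht ha
    refine prob_le_one.trans ?_
    rw [← ENNReal.ofReal_one]
    exact ENNReal.ofReal_le_ofReal (Real.one_le_rpow ((one_le_div hy).2 h) ha.le)

variable {Ω : Type*} {p : ℕ → Ω → ℝ × ℝ} {r : ℕ → Ω → ℝ} {A : Set (ℝ × ℝ)}

/-- Two to the number of targets in the region `A` with a reward above `y`. -/
def twoPow (p : ℕ → Ω → ℝ × ℝ) (r : ℕ → Ω → ℝ) (A : Set (ℝ × ℝ)) (y : ℝ) : Ω → ℝ≥0∞ :=
  markedProd p r A (fun x => if y < x then 2 else 1)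

theorem twoPow_eq {ω : Ω} (h : {i | p i ω ∈ A}.Finite) (y : ℝ) :
    twoPow p r A y ω = 2 ^ {i | p i ω ∈ A ∧ y < r i ω}.ncard := by
  classical
  rw [twoPow, markedProd_eq_prod (I := h.toFinset) (by simp), Finset.prod_ite]
  simp only [Finset.prod_const, one_pow, mul_one]
  congr 1
  rw [← Set.ncard_coe_finset]
  congr 1
  ext i
  simp

variable [MeasurableSpace Ω] {μ : Measure Ω} {lam : ℝ} {F : Measure ℝ}

theorem IsPoissonRewardField.measurable_twoPow (h : IsPoissonRewardField μ lam F p r)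
    (hA : MeasurableSet A) (y : ℝ) : Measurable (twoPow p r A y) :=
  h.measurable_markedProd hA (Measurable.ite measurableSet_Ioi measurable_const measurable_const)

/-- The mean of the mark factor is one plus the tail of `F`, so the generating functional gives the
exponential of the mean number of large rewards. -/
theorem IsPoissonRewardField.lintegral_twoPow [IsProbabilityMeasure F]
    (h : IsPoissonRewardField μ lam F p r)
    (hlam : 0 ≤ lam) (hA : MeasurableSet A) (hA' : volume A < ∞) (y : ℝ) :
    ∫⁻ ω, twoPow p r A y ω ∂μ =
      ENNReal.ofReal (Real.exp (lam * volume.real A * F.real (Ioi y))) := by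
  have hg : Measurable fun x : ℝ => if y < x then (2 : ℝ≥0∞) else 1 :=
    Measurable.ite measurableSet_Ioi measurable_const measurable_const
  have hG : ∫⁻ x, (if y < x then (2 : ℝ≥0∞) else 1) ∂F = ENNReal.ofReal (1 + F.real (Ioi y)) := by
    have : (fun x : ℝ => if y < x then (2 : ℝ≥0∞) else 1) =
        fun x => 1 + (Ioi y).indicator 1 x := by
      ext x
      by_cases hx : y < x <;> simp [hx, one_add_one_eq_two]
    rw [this, lintegral_add_left measurable_const, lintegral_indicator_one measurableSet_Ioi,
      ENNReal.ofReal_add zero_le_one measureReal_nonneg, ofReal_measureReal]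
    simp
  rw [twoPow, h.lintegral_markedProd hlam hA hA' hg (by positivity) hG]
  congr 2
  ring

theorem IsPoissonRewardField.measurableSet_forall_le (h : IsPoissonRewardField μ lam F p r)
    (hA : MeasurableSet A) (y : ℝ) : MeasurableSet {ω | ∀ i, p i ω ∈ A → r i ω ≤ y} := by
  have : {ω | ∀ i, p i ω ∈ A → r i ω ≤ y} = ⋂ i, ((p i ⁻¹' A)ᶜ ∪ r i ⁻¹' Iic y) := by
    ext ω
    simp [imp_iff_not_or]
  rw [this]
  exact MeasurableSet.iInter fun i => (h.poisson.measurable i hA).compl.union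
    (h.measurable_reward i measurableSet_Iic)

/-- The law of the largest reward in a region. -/
theorem IsPoissonRewardField.measure_forall_le [IsProbabilityMeasure F]
    (h : IsPoissonRewardField μ lam F p r)
    (hlam : 0 ≤ lam) (hA : MeasurableSet A) (hA' : volume A < ∞) (y : ℝ) :
    μ {ω | ∀ i, p i ω ∈ A → r i ω ≤ y} =
      ENNReal.ofReal (Real.exp (-(lam * volume.real A * F.real (Ioi y)))) := by
  -- With this mark function the product is the indicator of the event.
  have hg : Measurable ((Iic y).indicator (1 : ℝ → ℝ≥0∞)) :=
    measurable_one.indicator measurableSet_Iic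
  have hG : ∫⁻ x, (Iic y).indicator (1 : ℝ → ℝ≥0∞) x ∂F = ENNReal.ofReal (F.real (Iic y)) := by
    rw [lintegral_indicator_one measurableSet_Iic, ofReal_measureReal]
  have key := h.lintegral_markedProd hlam hA hA' hg measureReal_nonneg hG
  rw [show F.real (Iic y) = 1 - F.real (Ioi y) by
    rw [← compl_Ioi, probReal_compl_eq_one_sub measurableSet_Ioi]] at key
  rw [← lintegral_indicator_one (h.measurableSet_forall_le hA y)]
  rw [show -(lam * volume.real A * F.real (Ioi y)) =
    lam * volume.real A * (1 - F.real (Ioi y) - 1) by ring, ← key]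
  refine lintegral_congr_ae ?_
  filter_upwards [h.poisson.ae_finite hA hA'] with ω hω
  rw [markedProd_eq_prod (I := hω.toFinset) (by simp)]
  by_cases hall : ∀ i, p i ω ∈ A → r i ω ≤ y
  · rw [indicator_of_mem (by exact hall)]
    refine (Finset.prod_eq_one fun i hi => ?_).symm
    exact indicator_of_mem (s := Iic y) (hall i (by simpa using hi)) (1 : ℝ → ℝ≥0∞)
  · rw [indicator_of_notMem (by exact hall)]
    push Not at hall
    obtain ⟨i, hi, hy⟩ := hall
    refine (Finset.prod_eq_zero (i := i) (by simpa using hi) ?_).symm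
    simpa using hy

end

/-! ### Covering feasible paths by corridors -/

section

/-- The position after `k` steps of the walk with increments in `{-1, 0, 1}` coded by `σ`. -/
def walk {n : ℕ} (σ : Fin n → Fin 3) (k : ℕ) : ℤ :=
  ∑ j ∈ Finset.range k, if h : j < n then ((σ ⟨j, h⟩ : ℕ) : ℤ) - 1 else 0

/-- The union over `k < n` of the blocks of width `δ` and height `3 * δ` around the walk `σ`. -/
def corridor {n : ℕ} (δ : ℝ) (σ : Fin n → Fin 3) : Set (ℝ × ℝ) :=
  ⋃ k : Fin n, Icc (k * δ) ((k + 1) * δ) ×ˢ Icc ((walk σ k - 1) * δ) ((walk σ k + 2) * δ)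

theorem measurableSet_corridor {n : ℕ} (δ : ℝ) (σ : Fin n → Fin 3) :
    MeasurableSet (corridor δ σ) :=
  MeasurableSet.iUnion fun _ => measurableSet_Icc.prod measurableSet_Icc

theorem volume_corridor_le {n : ℕ} {δ : ℝ} (hδ : 0 ≤ δ) (σ : Fin n → Fin 3) :
    volume (corridor δ σ) ≤ ENNReal.ofReal (n * (3 * δ ^ 2)) := by
  refine (measure_iUnion_fintype_le _ _).trans ?_
  have : ∀ k : Fin n, volume (Icc (k * δ) ((k + 1) * δ) ×ˢ
      Icc ((walk σ k - 1) * δ) ((walk σ k + 2) * δ)) = ENNReal.ofReal (3 * δ ^ 2) := by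
    intro k
    rw [Measure.volume_eq_prod, Measure.prod_prod, Real.volume_Icc, Real.volume_Icc,
      ← ENNReal.ofReal_mul (by nlinarith)]
    congr 1
    ring
  rw [Finset.sum_congr rfl fun k _ => this k]
  simp [ENNReal.ofReal_mul]

/-- The graph of a `1`-Lipschitz function which vanishes at `0` lies in a corridor. -/
theorem exists_corridor {n : ℕ} (hn : n ≠ 0) {δ : ℝ} (hδ : 0 < δ) {h : ℝ → ℝ} (h0 : h 0 = 0)
    (hlip : ∀ s ∈ Icc 0 (n * δ), ∀ t ∈ Icc 0 (n * δ), |h s - h t| ≤ |s - t|) :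
    ∃ σ : Fin n → Fin 3, ∀ s ∈ Icc 0 (n * δ), (s, h s) ∈ corridor δ σ := by
  -- The row of the grid of mesh `δ` containing the graph at abscissa `k * δ`; by the Lipschitz
  -- bound it changes by at most one per column.
  set f : ℕ → ℤ := fun k => ⌊h (k * δ) / δ⌋ with hf
  have hfl : ∀ k : ℕ, f k * δ ≤ h (k * δ) := fun k => (le_div_iff₀ hδ).1 (Int.floor_le _)
  have hfu : ∀ k : ℕ, h (k * δ) < (f k + 1) * δ := fun k => (div_lt_iff₀ hδ).1 (Int.lt_floor_add_one _)
  have hmem : ∀ k : ℕ, k ≤ n → (k : ℝ) * δ ∈ Icc 0 (n * δ) := fun k hk =>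
    ⟨by positivity, by gcongr⟩
  have hstep : ∀ k, k < n → -1 ≤ f (k + 1) - f k ∧ f (k + 1) - f k ≤ 1 := by
    intro k hk
    have h1 := hlip _ (hmem (k + 1) hk) _ (hmem k hk.le)
    rw [show ((k + 1 : ℕ) : ℝ) * δ - k * δ = δ by push_cast; ring, abs_of_pos hδ, abs_le] at h1
    have a1 := hfl k
    have a2 := hfu k
    have a3 := hfl (k + 1)
    have a4 := hfu (k + 1)
    constructor
    · have : (f k : ℝ) < f (k + 1) + 2 := by
        refine lt_of_mul_lt_mul_right ?_ hδ.le
        linarith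
      have : f k < f (k + 1) + 2 := by exact_mod_cast this
      omega
    · have : (f (k + 1) : ℝ) < f k + 2 := by
        refine lt_of_mul_lt_mul_right ?_ hδ.le
        linarith
      have : f (k + 1) < f k + 2 := by exact_mod_cast this
      omega
  let σ : Fin n → Fin 3 := fun k => ⟨(f (k + 1) - f k + 1).toNat, by
    have := hstep k k.2
    omega⟩
  have hwalk : ∀ k, k ≤ n → walk σ k = f k := by
    intro k
    induction k with
    | zero => intro _; simp [walk, hf, h0]
    | succ k ih =>
      intro hk
      have h1 := ih (by omega)
      have h2 := hstep k (by omega)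
      rw [walk] at h1 ⊢
      rw [Finset.sum_range_succ, h1, dif_pos (by omega : k < n)]
      simp only [σ]
      omega
  refine ⟨σ, fun s hs => ?_⟩
  -- The right endpoint `s = n * δ` is assigned to the last column.
  obtain ⟨k, hk, hk1, hk2⟩ : ∃ k < n, (k : ℝ) * δ ≤ s ∧ s ≤ (k + 1) * δ := by
    rcases lt_or_ge ⌊s / δ⌋₊ n with hlt | hge
    · refine ⟨⌊s / δ⌋₊, hlt, ?_, ?_⟩
      · exact (le_div_iff₀ hδ).1 (Nat.floor_le (div_nonneg hs.1 hδ.le))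
      · exact ((div_lt_iff₀ hδ).1 (Nat.lt_floor_add_one _)).le
    · have h1 : (n : ℝ) ≤ s / δ := (Nat.le_floor_iff (div_nonneg hs.1 hδ.le)).1 hge
      have h2 : ((n - 1 : ℕ) : ℝ) + 1 = n := by
        exact_mod_cast Nat.succ_pred_eq_of_ne_zero hn
      refine ⟨n - 1, by omega, ?_, ?_⟩
      · refine le_trans ?_ ((le_div_iff₀ hδ).1 h1)
        gcongr
        omega
      · rw [h2]
        exact hs.2
  refine mem_iUnion.2 ⟨⟨k, hk⟩, ⟨hk1, hk2⟩, ?_⟩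
  -- Within a column the graph moves by at most `δ`, so it stays in its initial row and the two
  -- adjacent ones.
  have h1 := hlip _ hs _ (hmem k hk.le)
  rw [abs_of_nonneg (sub_nonneg.2 hk1), abs_le] at h1
  have a1 := hfl k
  have a2 := hfu k
  simp only [hwalk k hk.le, mem_Icc]
  constructor <;> linarith

variable {v L : ℝ} {x : ℝ → ℝ × ℝ}

/-- Reparametrizing by the longitudinal coordinate divides the transversal speed by `v`, which
bounds the slope by one. -/
theorem IsFeasiblePath.exists_graph (hv : 0 < v) (hx : IsFeasiblePath v L x) :
    ∃ h : ℝ → ℝ, h 0 = 0 ∧ (∀ s t, |h s - h t| ≤ |s - t|) ∧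
      ∀ t ∈ Icc 0 (L / v), x t = (v * t, h (v * t)) := by
  obtain ⟨u, hu, huv, hx⟩ := hx
  have hint : ∀ a b, IntervalIntegrable u volume a b := fun a b =>
    (intervalIntegrable_const (c := v)).mono_fun hu.aestronglyMeasurable
      (ae_of_all _ fun t => by simpa [abs_of_pos hv] using huv t)
  refine ⟨fun s => ∫ t in (0 : ℝ)..(s / v), u t, by simp, fun s t => ?_, fun t ht => ?_⟩
  · rw [intervalIntegral.integral_interval_sub_left (hint _ _) (hint _ _)]
    refine (intervalIntegral.norm_integral_le_of_norm_le_const (C := v)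
      fun t _ => (Real.norm_eq_abs (u t)).trans_le (huv t)).trans_eq ?_
    rw [← sub_div, abs_div, abs_of_pos hv]
    field_simp
  · rw [hx t ht]
    simp [hv.ne', mul_comm]

theorem IsFeasiblePath.exists_corridor (hv : 0 < v) (hL : 0 < L) (hx : IsFeasiblePath v L x)
    {n : ℕ} (hn : n ≠ 0) :
    ∃ σ : Fin n → Fin 3, ∀ t ∈ Icc 0 (L / v), x t ∈ corridor (L / n) σ := by
  obtain ⟨h, h0, hlip, hx⟩ := hx.exists_graph hv
  have hn' : (0 : ℝ) < n := by positivity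
  obtain ⟨σ, hσ⟩ := RewardField.exists_corridor hn (div_pos hL hn') h0 fun s _ t _ => hlip s t
  refine ⟨σ, fun t ht => ?_⟩
  rw [hx t ht]
  refine hσ _ ⟨mul_nonneg hv.le ht.1, ?_⟩
  rw [mul_div_cancel₀ _ hn'.ne', mul_comm]
  exact (le_div_iff₀ hv).1 ht.2

theorem IsFeasiblePath.mem_box (hv : 0 < v) (hx : IsFeasiblePath v L x) {t : ℝ}
    (ht : t ∈ Icc 0 (L / v)) : x t ∈ Icc 0 L ×ˢ Icc (-L) L := by
  obtain ⟨h, h0, hlip, hx⟩ := hx.exists_graph hv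
  have h1 : v * t ≤ L := mul_comm v t ▸ (le_div_iff₀ hv).1 ht.2
  have h2 := mul_nonneg hv.le ht.1
  have h3 := hlip (v * t) 0
  rw [h0, sub_zero, sub_zero, abs_of_nonneg h2, abs_le] at h3
  rw [hx t ht]
  exact ⟨⟨h2, h1⟩, by linarith, by linarith⟩

/-- Every point of the cone of slope one can be reached. -/
theorem exists_isFeasiblePath (hv : 0 < v) {z : ℝ × ℝ} (h0 : 0 < z.1) (hL : z.1 ≤ L)
    (hz : |z.2| ≤ z.1) : ∃ x, IsFeasiblePath v L x ∧ ∃ t ∈ Icc 0 (L / v), x t = z := by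
  refine ⟨_, ⟨fun _ => v * (z.2 / z.1), measurable_const, fun _ => ?_, fun t _ => rfl⟩,
    z.1 / v, ⟨by positivity, by gcongr⟩, ?_⟩
  · rw [abs_mul, abs_of_pos hv, abs_div, abs_of_pos h0]
    exact mul_le_of_le_one_right hv.le ((div_le_one h0).2 hz)
  · ext
    · simp [hv.ne']
    · simp
      field_simp

end

/-! ### Counting large rewards along a path, and dyadic layers -/

section

/-- Any excess `k = N - m` is at most `2 ^ k`. This turns exponential moments into a bound on the
mean of a maximum. -/
theorem natCast_le_add_two_pow_mul_inv (N m : ℕ) : (N : ℝ≥0∞) ≤ m + 2 ^ N * (2 ^ m)⁻¹ := by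
  rcases le_total N m with h | h
  · exact le_add_right (by exact_mod_cast h)
  · obtain ⟨k, rfl⟩ := Nat.exists_eq_add_of_le h
    rw [← div_eq_mul_inv, pow_add, mul_comm, ENNReal.mul_div_cancel_right (by simp) (by simp)]
    push_cast
    gcongr
    exact_mod_cast Nat.lt_two_pow_self.le

variable {Ω : Type*} [MeasurableSpace Ω] {μ : Measure Ω} [IsProbabilityMeasure μ] {lam : ℝ}
  {p : ℕ → Ω → ℝ × ℝ} {r : ℕ → Ω → ℝ}

/-- The mean number of targets with reward above `y` that a path can visit is at most of order `n`,
if the mean number of such targets in a square of side `L` is at most of order `n ^ 2`. -/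
theorem IsPoissonRewardField.exists_encard_visited_le {F : Measure ℝ} [IsProbabilityMeasure F]
    (h : IsPoissonRewardField μ lam F p r) (hlam : 0 ≤ lam) :
    ∃ C : ℝ, 0 < C ∧ ∀ v L : ℝ, 0 < v → 0 < L → ∀ n : ℕ, n ≠ 0 → ∀ y : ℝ,
      L ^ 2 * F.real (Ioi y) ≤ n ^ 2 → ∃ W : Ω → ℝ≥0∞, Measurable W ∧
        ∫⁻ ω, W ω ∂μ ≤ ENNReal.ofReal (C * n) ∧ ∀ᵐ ω ∂μ, ∀ x, IsFeasiblePath v L x →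
          ({i | i ∈ visited p v L x ω ∧ y < r i ω}.encard : ℝ≥0∞) ≤ W ω := by
  -- Per column there are `3` choices of step and a factor `exp (3 * lam)` from the exponential
  -- moment; `2 ^ a` absorbs both.
  obtain ⟨a, ha⟩ := pow_unbounded_of_one_lt (3 * Real.exp (3 * lam)) one_lt_two
  refine ⟨a + 1, by positivity, fun v L hv hL n hn y hy => ?_⟩
  have hn' : (0 : ℝ) < n := by positivity
  have hn1 : (1 : ℝ) ≤ n := by exact_mod_cast Nat.one_le_iff_ne_zero.2 hn
  have hmeas := fun σ : Fin n → Fin 3 => measurableSet_corridor (L / n) σ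
  have hvol := fun σ : Fin n → Fin 3 => volume_corridor_le (div_nonneg hL.le hn'.le) σ
  have hfin := fun σ : Fin n → Fin 3 => (hvol σ).trans_lt ENNReal.ofReal_lt_top
  refine ⟨fun ω => (a * n : ℕ) + (∑ σ : Fin n → Fin 3, twoPow p r (corridor (L / n) σ) y ω) *
    (2 ^ (a * n))⁻¹, ?_, ?_, ?_⟩
  · exact ((Finset.measurable_fun_sum _ fun σ _ =>
      h.measurable_twoPow (hmeas σ) y).mul_const _).const_add _
  · have hσ : ∀ σ : Fin n → Fin 3, ∫⁻ ω, twoPow p r (corridor (L / n) σ) y ω ∂μ ≤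
        ENNReal.ofReal (Real.exp (3 * lam) ^ n) := by
      intro σ
      rw [h.lintegral_twoPow hlam (hmeas σ) (hfin σ), ← Real.exp_nat_mul]
      refine ENNReal.ofReal_le_ofReal (Real.exp_le_exp.2 ?_)
      have h1 : volume.real (corridor (L / n) σ) ≤ n * (3 * (L / n) ^ 2) :=
        ENNReal.toReal_le_of_le_ofReal (by positivity) (hvol σ)
      calc lam * volume.real (corridor (L / n) σ) * F.real (Ioi y)
          ≤ lam * (n * (3 * (L / n) ^ 2)) * F.real (Ioi y) := by gcongr
        _ = 3 * lam / n * (L ^ 2 * F.real (Ioi y)) := by field_simp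
        _ ≤ 3 * lam / n * n ^ 2 := by gcongr
        _ = n * (3 * lam) := by field_simp
    rw [lintegral_add_left measurable_const, lintegral_mul_const' _ _ (by simp),
      lintegral_finsetSum _ fun σ _ => h.measurable_twoPow (hmeas σ) y]
    have hsum : (∑ σ : Fin n → Fin 3, ∫⁻ ω, twoPow p r (corridor (L / n) σ) y ω ∂μ) ≤
        2 ^ (a * n) := by
      refine (Finset.sum_le_sum fun σ _ => hσ σ).trans ?_
      rw [Finset.sum_const, Finset.card_univ, Fintype.card_fun, Fintype.card_fin, Fintype.card_fin,
        nsmul_eq_mul, pow_mul]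
      have : ((3 ^ n : ℕ) : ℝ≥0∞) * ENNReal.ofReal (Real.exp (3 * lam) ^ n) =
          ENNReal.ofReal ((3 * Real.exp (3 * lam)) ^ n) := by
        rw [mul_pow, ENNReal.ofReal_mul (by positivity)]
        congr 1
        rw [ENNReal.ofReal_pow (by norm_num)]
        simp
      rw [this]
      have h2 : ((2 : ℝ≥0∞) ^ a) ^ n = ENNReal.ofReal (((2 : ℝ) ^ a) ^ n) := by
        rw [ENNReal.ofReal_pow (by positivity), ENNReal.ofReal_pow (by positivity)]
        simp
      rw [h2]
      refine ENNReal.ofReal_le_ofReal ?_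
      gcongr
    calc _ ≤ ((a * n : ℕ) : ℝ≥0∞) + 2 ^ (a * n) * (2 ^ (a * n))⁻¹ := by
          simp only [lintegral_const, measure_univ, mul_one]
          gcongr
      _ = ENNReal.ofReal (a * n + 1) := by
          rw [ENNReal.mul_inv_cancel (by simp) (by simp), ENNReal.ofReal_add (by positivity)
            zero_le_one, ENNReal.ofReal_one, ← Nat.cast_mul, ENNReal.ofReal_natCast]
      _ ≤ _ := ENNReal.ofReal_le_ofReal (by linarith)
  · have hae : ∀ᵐ ω ∂μ, ∀ σ : Fin n → Fin 3, {i | p i ω ∈ corridor (L / n) σ}.Finite :=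
      ae_all_iff.2 fun σ => h.poisson.ae_finite (hmeas σ) (hfin σ)
    filter_upwards [hae] with ω hω x hx
    obtain ⟨σ, hσ⟩ := hx.exists_corridor hv hL hn
    have hsub : {i | i ∈ visited p v L x ω ∧ y < r i ω} ⊆
        {i | p i ω ∈ corridor (L / n) σ ∧ y < r i ω} := by
      rintro i ⟨⟨t, ht, hti⟩, hi⟩
      exact ⟨hti ▸ hσ t ht, hi⟩
    have hfin' : {i | p i ω ∈ corridor (L / n) σ ∧ y < r i ω}.Finite :=
      (hω σ).subset fun i hi => hi.1
    have h1 : ({i | i ∈ visited p v L x ω ∧ y < r i ω}.encard : ℝ≥0∞) ≤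
        ({i | p i ω ∈ corridor (L / n) σ ∧ y < r i ω}.ncard : ℝ≥0∞) := by
      have := Set.encard_le_encard hsub
      rw [← hfin'.cast_ncard_eq] at this
      exact_mod_cast this
    refine (h1.trans (natCast_le_add_two_pow_mul_inv _ (a * n))).trans ?_
    rw [← twoPow_eq (hω σ)]
    gcongr
    exact Finset.single_le_sum (f := fun σ => twoPow p r (corridor (L / n) σ) y ω)
      (fun _ _ => zero_le) (Finset.mem_univ σ)

/-- Each positive number up to `Y` lies above some dyadic fraction of `Y` by a factor at most two. -/
theorem ofReal_le_tsum_dyadic {Y z : ℝ} (hz : z ≤ Y) :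
    ENNReal.ofReal z ≤ ∑' j : ℕ, ENNReal.ofReal (Y / 2 ^ j) *
      (if Y / 2 ^ (j + 1) < z then 1 else 0) := by
  rcases le_or_gt z 0 with h0 | h0
  · simp [ENNReal.ofReal_of_nonpos h0]
  have hY : 0 < Y := h0.trans_le hz
  obtain ⟨j, hj1, hj2⟩ : ∃ j : ℕ, Y / 2 ^ (j + 1) < z ∧ z ≤ Y / 2 ^ j := by
    have hex : ∃ j : ℕ, Y / 2 ^ j < z := by
      obtain ⟨j, hj⟩ := pow_unbounded_of_one_lt (Y / z) one_lt_two
      exact ⟨j, (div_lt_comm₀ h0 (by positivity)).1 hj⟩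
    classical
    have h1 := Nat.find_spec hex
    have hpos : Nat.find hex ≠ 0 := fun h => by
      rw [h] at h1
      simp at h1
      linarith
    obtain ⟨j, hj⟩ := Nat.exists_eq_succ_of_ne_zero hpos
    refine ⟨j, by rwa [hj] at h1, not_lt.1 (Nat.find_min hex (by omega))⟩
  refine le_trans ?_ (ENNReal.le_tsum j)
  rw [if_pos hj1, mul_one]
  exact ENNReal.ofReal_le_ofReal hj2

/-- Bound each reward by its dyadic sum and exchange the two sums; this reduces total rewards to
counts above levels. -/
theorem tsum_reward_le {S : Set ℕ} {z : ℕ → ℝ} {Y : ℝ} (hz : ∀ i ∈ S, z i ≤ Y) :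
    ∑' i : S, ENNReal.ofReal (z i) ≤ ∑' j : ℕ, ENNReal.ofReal (Y / 2 ^ j) *
      ({i | i ∈ S ∧ Y / 2 ^ (j + 1) < z i}.encard : ℝ≥0∞) := by
  refine (ENNReal.tsum_le_tsum fun i : S => ofReal_le_tsum_dyadic (hz i i.2)).trans_eq ?_
  rw [ENNReal.tsum_comm]
  refine tsum_congr fun j => ?_
  rw [ENNReal.tsum_mul_left, ← ENNReal.tsum_set_one, tsum_subtype S
    (fun i => if Y / 2 ^ (j + 1) < z i then (1 : ℝ≥0∞) else 0),
    tsum_subtype {i | i ∈ S ∧ Y / 2 ^ (j + 1) < z i} (fun _ => (1 : ℝ≥0∞))]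
  congr 1
  refine tsum_congr fun i => ?_
  by_cases h1 : i ∈ S <;> by_cases h2 : Y / 2 ^ (j + 1) < z i <;> simp [h1, h2]

end

/-! ### Orders of magnitude of the optimal reward -/

section

variable {Ω : Type*} [MeasurableSpace Ω] {μ : Measure Ω}
  {lam v xm α : ℝ} {p : ℕ → Ω → ℝ × ℝ} {r : ℕ → Ω → ℝ}

theorem paretoMeasure_real_Ioi_le {t a y : ℝ} (ht : 0 < t) (ha : 0 < a) (hy : 0 < y) :
    (paretoMeasure t a).real (Ioi y) ≤ (t / y) ^ a :=
  ENNReal.toReal_le_of_le_ofReal (by positivity) (paretoMeasure_Ioi_le ht ha hy)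

/-- The scaling relation between the side `L` of a square and the rewards of order `L ^ (2 / α)`. -/
theorem sq_mul_div_rpow {K L : ℝ} (hxm : 0 < xm) (hα : 0 < α) (hK : 0 < K) (hL : 0 < L) :
    L ^ 2 * (xm / (K * L ^ (2 / α))) ^ α = (xm / K) ^ α := by
  rw [← div_div, Real.div_rpow (by positivity) (by positivity), ← Real.rpow_mul hL.le,
    div_mul_cancel₀ _ hα.ne', Real.rpow_two]
  field_simp

/-- If no reward exceeds `K * L ^ (2 / α)`, then the optimal total reward is bounded by a random
variable with mean of order `L ^ (2 / α)`. -/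
theorem IsPoissonRewardField.exists_optimalReward_le [IsProbabilityMeasure μ]
    (h : IsPoissonRewardField μ lam (paretoMeasure xm α) p r) (hlam : 0 ≤ lam) (hv : 0 < v)
    (hxm : 0 < xm) (hα : 0 < α) (hα2 : α < 2) {K : ℝ} (hK : 0 < K) :
    ∃ C : ℝ, 0 < C ∧ ∀ L : ℝ, 0 < L → ∃ Z : Ω → ℝ≥0∞, Measurable Z ∧
      ∫⁻ ω, Z ω ∂μ ≤ ENNReal.ofReal (C * L ^ (2 / α)) ∧
      ∀ᵐ ω ∂μ, (∀ i, p i ω ∈ Icc 0 L ×ˢ Icc (-L) L → r i ω ≤ K * L ^ (2 / α)) →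
        optimalReward p r v L ω ≤ Z ω := by
  have := isProbabilityMeasure_paretoMeasure hxm hα
  obtain ⟨C, hC, hW⟩ := h.exists_encard_visited_le hlam
  -- `κ * β ^ j` is the square root of `L ^ 2` times the Pareto tail bound at level `Y / 2 ^ (j +
  -- 1)`; by scaling it does not depend on `L`.
  set κ : ℝ := (xm * 2 / K) ^ (α / 2) with hκ
  set β : ℝ := 2 ^ (α / 2) with hβ
  have hκ0 : 0 < κ := by positivity
  have hβ1 : 1 ≤ β := Real.one_le_rpow one_le_two (by positivity)
  have hβ2 : β / 2 < 1 := by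
    rw [div_lt_one two_pos]
    calc β < 2 ^ (1 : ℝ) := Real.rpow_lt_rpow_of_exponent_lt one_lt_two (by linarith)
      _ = 2 := Real.rpow_one 2
  have hβ0 : 0 ≤ β / 2 := by positivity
  refine ⟨K * C * (κ + 1) * (1 - β / 2)⁻¹,
    mul_pos (by positivity) (inv_pos.2 (by linarith)), fun L hL => ?_⟩
  set Y : ℝ := K * L ^ (2 / α) with hY
  have hY0 : 0 < Y := by positivity
  -- The floor plus one gives a nonzero integer number of columns, even when `κ * β ^ j` is small.
  have hlevel : ∀ j : ℕ, L ^ 2 * (paretoMeasure xm α).real (Ioi (Y / 2 ^ (j + 1))) ≤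
      ((⌊κ * β ^ j⌋₊ + 1 : ℕ) : ℝ) ^ 2 := by
    intro j
    have h1 : (κ * β ^ j) ^ 2 = L ^ 2 * (xm / (Y / 2 ^ (j + 1))) ^ α := by
      have e1 : xm / (Y / 2 ^ (j + 1)) = xm / Y * 2 * 2 ^ j := by
        rw [pow_succ]
        field_simp
      have e2 : κ ^ 2 = (xm / K) ^ α * 2 ^ α := by
        rw [hκ, ← Real.mul_rpow (by positivity) (by positivity), ← Real.rpow_mul_natCast
          (by positivity)]
        congr 1
        · ring
        · push_cast
          ring
      have e3 : (β ^ j) ^ 2 = ((2 : ℝ) ^ j) ^ α := by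
        rw [← pow_mul, mul_comm, pow_mul, hβ, ← Real.rpow_mul_natCast (by positivity),
          show α / 2 * (2 : ℕ) = α by push_cast; ring, Real.rpow_pow_comm (by positivity)]
      rw [mul_pow, e1, e2, e3, Real.mul_rpow (by positivity) (by positivity),
        Real.mul_rpow (by positivity) (by positivity), ← sq_mul_div_rpow hxm hα hK hL]
      ring
    calc L ^ 2 * (paretoMeasure xm α).real (Ioi (Y / 2 ^ (j + 1)))
        ≤ L ^ 2 * (xm / (Y / 2 ^ (j + 1))) ^ α := by
          gcongr
          exact paretoMeasure_real_Ioi_le hxm hα (by positivity)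
      _ = (κ * β ^ j) ^ 2 := h1.symm
      _ ≤ _ := by
          gcongr
          push_cast
          exact (Nat.lt_floor_add_one _).le
  choose W hWm hWi hWae using fun j : ℕ =>
    hW v L hv hL (⌊κ * β ^ j⌋₊ + 1) (Nat.succ_ne_zero _) (Y / 2 ^ (j + 1)) (hlevel j)
  refine ⟨fun ω => ∑' j : ℕ, ENNReal.ofReal (Y / 2 ^ j) * W j ω,
    Measurable.tsum fun j => (hWm j).const_mul _, ?_, ?_⟩
  · rw [lintegral_tsum fun j => ((hWm j).const_mul _).aemeasurable]
    have hterm : ∀ j : ℕ, ∫⁻ ω, ENNReal.ofReal (Y / 2 ^ j) * W j ω ∂μ ≤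
        ENNReal.ofReal (Y * C * (κ + 1) * (β / 2) ^ j) := by
      intro j
      rw [lintegral_const_mul _ (hWm j)]
      refine (mul_le_mul_right (hWi j) _).trans ?_
      rw [← ENNReal.ofReal_mul (by positivity)]
      refine ENNReal.ofReal_le_ofReal ?_
      have hβj : 1 ≤ β ^ j := one_le_pow₀ hβ1
      have hn : ((⌊κ * β ^ j⌋₊ + 1 : ℕ) : ℝ) ≤ (κ + 1) * β ^ j := by
        push_cast
        have := Nat.floor_le (by positivity : 0 ≤ κ * β ^ j)
        linarith
      calc Y / 2 ^ j * (C * ((⌊κ * β ^ j⌋₊ + 1 : ℕ) : ℝ))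
          ≤ Y / 2 ^ j * (C * ((κ + 1) * β ^ j)) := by gcongr
        _ = Y * C * (κ + 1) * (β / 2) ^ j := by
          rw [div_pow]
          ring
    refine (ENNReal.tsum_le_tsum hterm).trans_eq ?_
    have hsum := (hasSum_geometric_of_lt_one hβ0 hβ2).mul_left (Y * C * (κ + 1))
    rw [← ENNReal.ofReal_tsum_of_nonneg (fun j => by positivity) hsum.summable, hsum.tsum_eq, hY]
    congr 1
    ring
  · filter_upwards [ae_all_iff.2 hWae] with ω hω hbox
    refine iSup₂_le fun x hx => (tsum_reward_le (Y := Y) ?_).trans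
      (ENNReal.tsum_le_tsum fun j => mul_le_mul_right (hω j x hx) _)
    rintro i ⟨t, ht, hti⟩
    exact hbox i (hti ▸ hx.mem_box hv ht)

theorem IsPoissonRewardField.isBigOInProbability_optimalReward [IsProbabilityMeasure μ]
    (h : IsPoissonRewardField μ lam (paretoMeasure xm α) p r) (hlam : 0 < lam) (hv : 0 < v)
    (hxm : 0 < xm) (hα : 0 < α) (hα2 : α < 2) :
    IsBigOInProbability μ (fun L => optimalReward p r v L) (fun L => L ^ (2 / α)) := by
  intro ε hε
  have := isProbabilityMeasure_paretoMeasure hxm hα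
  -- Chosen so that the box of area `2 * L ^ 2` contains on average at most `ε / 2` targets with
  -- reward above `K * L ^ (2 / α)`.
  set K : ℝ := xm * (4 * lam / ε) ^ (1 / α) with hKdef
  have hK : 0 < K := by positivity
  have hKα : (xm / K) ^ α = ε / (4 * lam) := by
    rw [hKdef, div_mul_cancel_left₀ hxm.ne', Real.inv_rpow (by positivity),
      ← Real.rpow_mul (by positivity), one_div_mul_cancel hα.ne', Real.rpow_one, inv_div]
  obtain ⟨C, hC, hZ⟩ := h.exists_optimalReward_le hlam.le hv hxm hα hα2 hK
  refine ⟨2 * C / ε, by positivity, ?_⟩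
  filter_upwards [eventually_gt_atTop 0] with L hL
  obtain ⟨Z, hZm, hZi, hZae⟩ := hZ L hL
  have ha : 0 < L ^ (2 / α) := by positivity
  set B : Set (ℝ × ℝ) := Icc 0 L ×ˢ Icc (-L) L
  have hB : MeasurableSet B := measurableSet_Icc.prod measurableSet_Icc
  have hBvol : volume B = ENNReal.ofReal (2 * L ^ 2) := by
    rw [Measure.volume_eq_prod, Measure.prod_prod, Real.volume_Icc, Real.volume_Icc,
      ← ENNReal.ofReal_mul (by linarith)]
    congr 1
    ring
  set E : Set Ω := {ω | ∀ i, p i ω ∈ B → r i ω ≤ K * L ^ (2 / α)} with hE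
  have hEc : μ Eᶜ ≤ ENNReal.ofReal (ε / 2) := by
    rw [prob_compl_eq_one_sub (h.measurableSet_forall_le hB _),
      h.measure_forall_le hlam.le hB (hBvol ▸ ENNReal.ofReal_lt_top), ← ENNReal.ofReal_one,
      ← ENNReal.ofReal_sub _ (Real.exp_pos _).le]
    refine ENNReal.ofReal_le_ofReal ?_
    have h1 : volume.real B = 2 * L ^ 2 := by
      rw [measureReal_def, hBvol, ENNReal.toReal_ofReal (by positivity)]
    have h2 : L ^ 2 * (paretoMeasure xm α).real (Ioi (K * L ^ (2 / α))) ≤ ε / (4 * lam) := by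
      rw [← hKα, ← sq_mul_div_rpow hxm hα hK hL]
      gcongr
      exact paretoMeasure_real_Ioi_le hxm hα (by positivity)
    have h3 := Real.add_one_le_exp
      (-(lam * volume.real B * (paretoMeasure xm α).real (Ioi (K * L ^ (2 / α)))))
    have h4 : lam * volume.real B * (paretoMeasure xm α).real (Ioi (K * L ^ (2 / α))) ≤ ε / 2 := by
      rw [h1]
      calc _ = 2 * lam * (L ^ 2 * (paretoMeasure xm α).real (Ioi (K * L ^ (2 / α)))) := by ring
        _ ≤ 2 * lam * (ε / (4 * lam)) := by gcongr
        _ = ε / 2 := by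
          field_simp
          norm_num
    linarith
  have hMarkov : μ {ω | ENNReal.ofReal (2 * C / ε * L ^ (2 / α)) ≤ Z ω} ≤
      ENNReal.ofReal (ε / 2) := by
    have hpos : 0 < 2 * C / ε * L ^ (2 / α) := by positivity
    refine (meas_ge_le_lintegral_div hZm.aemeasurable
      (ENNReal.ofReal_pos.2 hpos).ne' ENNReal.ofReal_ne_top).trans ?_
    refine (ENNReal.div_le_div_right hZi _).trans_eq ?_
    rw [← ENNReal.ofReal_div_of_pos hpos]
    congr 1
    field_simp
  calc μ {ω | ENNReal.ofReal (2 * C / ε * L ^ (2 / α)) < optimalReward p r v L ω}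
      ≤ μ (Eᶜ ∪ {ω | ENNReal.ofReal (2 * C / ε * L ^ (2 / α)) ≤ Z ω}) := by
        refine measure_mono_ae ?_
        filter_upwards [hZae] with ω hω hlt
        by_cases hEω : ω ∈ E
        · exact Or.inr ((show _ < _ from hlt).le.trans (hω hEω))
        · exact Or.inl hEω
    _ ≤ ENNReal.ofReal (ε / 2) + ENNReal.ofReal (ε / 2) :=
        (measure_union_le _ _).trans (add_le_add hEc hMarkov)
    _ = ENNReal.ofReal ε := by
        rw [← ENNReal.ofReal_add (by positivity) (by positivity), add_halves]

/-- With high probability a single reachable target has a reward of order `L ^ (2 / α)`. -/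
theorem IsPoissonRewardField.exists_event_le_optimalReward
    (h : IsPoissonRewardField μ lam (paretoMeasure xm α) p r) (hlam : 0 < lam) (hv : 0 < v)
    (hxm : 0 < xm) (hα : 0 < α) {ε : ℝ} (hε : 0 < ε) :
    ∃ c : ℝ, 0 < c ∧ ∀ᶠ L : ℝ in atTop, ∃ H : Set Ω, MeasurableSet H ∧
      μ Hᶜ ≤ ENNReal.ofReal ε ∧
      ∀ ω ∈ H, ENNReal.ofReal (c * L ^ (2 / α)) ≤ optimalReward p r v L ω := by
  have := isProbabilityMeasure_paretoMeasure hxm hα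
  -- `M` is the mean number of large rewards in the box below, and `exp (-M) ≤ ε`; the `1` keeps it
  -- positive when `ε ≥ 1`. The constant `c` is then solved from this mean.
  set M : ℝ := max 1 (-Real.log ε) with hM
  have hM0 : 0 < M := lt_max_of_lt_left one_pos
  set c : ℝ := xm * (lam / (2 * M)) ^ (1 / α) with hcdef
  have hc : 0 < c := by positivity
  have hcα : (xm / c) ^ α = 2 * M / lam := by
    rw [hcdef, div_mul_cancel_left₀ hxm.ne', Real.inv_rpow (by positivity),
      ← Real.rpow_mul (by positivity), one_div_mul_cancel hα.ne', Real.rpow_one, inv_div]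
  refine ⟨c, hc, ?_⟩
  have hlim : Tendsto (fun L : ℝ => c * L ^ (2 / α)) atTop atTop :=
    (tendsto_rpow_atTop (by positivity)).const_mul_atTop hc
  -- The level must reach `xm`, since the exact Pareto tail is needed here.
  filter_upwards [eventually_gt_atTop 0, hlim.eventually_ge_atTop xm] with L hL hxmL
  -- This square lies in the cone of slope one, so each of its points can be visited.
  set B : Set (ℝ × ℝ) := Icc (L / 2) L ×ˢ Icc (-(L / 2)) (L / 2)
  have hB : MeasurableSet B := measurableSet_Icc.prod measurableSet_Icc
  have hBvol : volume B = ENNReal.ofReal (L ^ 2 / 2) := by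
    rw [Measure.volume_eq_prod, Measure.prod_prod, Real.volume_Icc, Real.volume_Icc,
      ← ENNReal.ofReal_mul (by linarith)]
    congr 1
    ring
  refine ⟨{ω | ∀ i, p i ω ∈ B → r i ω ≤ c * L ^ (2 / α)}ᶜ,
    (h.measurableSet_forall_le hB _).compl, ?_, fun ω hω => ?_⟩
  · rw [compl_compl, h.measure_forall_le hlam.le hB (hBvol ▸ ENNReal.ofReal_lt_top)]
    refine ENNReal.ofReal_le_ofReal ?_
    have h1 : volume.real B = L ^ 2 / 2 := by
      rw [measureReal_def, hBvol, ENNReal.toReal_ofReal (by positivity)]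
    have h2 : (paretoMeasure xm α).real (Ioi (c * L ^ (2 / α))) =
        (xm / (c * L ^ (2 / α))) ^ α := by
      rw [measureReal_def, paretoMeasure_Ioi hxm hα hxmL, ENNReal.toReal_ofReal (by positivity)]
    have h3 : lam * volume.real B * (paretoMeasure xm α).real (Ioi (c * L ^ (2 / α))) = M := by
      rw [h1, h2]
      calc _ = lam / 2 * (L ^ 2 * (xm / (c * L ^ (2 / α))) ^ α) := by ring
        _ = M := by
          rw [sq_mul_div_rpow hxm hα hc hL, hcα]
          field_simp
    rw [h3]
    calc Real.exp (-M) ≤ Real.exp (Real.log ε) :=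
          Real.exp_le_exp.2 (by linarith [le_max_right 1 (-Real.log ε)])
      _ = ε := Real.exp_log hε
  · simp only [mem_compl_iff, mem_ofPred_eq, not_forall, not_le] at hω
    obtain ⟨i, ⟨hi1, hi2⟩, hi⟩ := hω
    obtain ⟨x, hx, t, ht, hxt⟩ := exists_isFeasiblePath hv (lt_of_lt_of_le (by positivity) hi1.1)
      hi1.2 ((abs_le.2 hi2).trans hi1.1)
    refine le_trans (ENNReal.ofReal_le_ofReal hi.le) (le_trans ?_ (le_iSup₂ x hx))
    exact ENNReal.le_tsum (f := fun i : visited p v L x ω => ENNReal.ofReal (r i ω))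
      ⟨i, t, ht, hxt⟩

theorem IsPoissonRewardField.isBigOmegaInProbability_optimalReward
    (h : IsPoissonRewardField μ lam (paretoMeasure xm α) p r) (hlam : 0 < lam) (hv : 0 < v)
    (hxm : 0 < xm) (hα : 0 < α) :
    IsBigOmegaInProbability μ (fun L => optimalReward p r v L) (fun L => L ^ (2 / α)) := by
  intro ε hε
  obtain ⟨c, hc, hH⟩ := h.exists_event_le_optimalReward hlam hv hxm hα hε
  refine ⟨c, hc, ?_⟩
  filter_upwards [hH] with L hL
  obtain ⟨H, -, hHε, hle⟩ := hL
  exact (measure_mono fun ω hω hωH => (hle ω hωH).not_gt hω).trans hHε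

theorem ofReal_mul_rpow_sub_one {c L : ℝ} (hL : 0 < L) (s : ℝ) :
    ENNReal.ofReal (c * L ^ (s - 1)) = ENNReal.ofReal (c * L ^ s) / ENNReal.ofReal L := by
  rw [← ENNReal.ofReal_div_of_pos hL, Real.rpow_sub_one hL.ne', mul_div_assoc]

theorem IsBigOInProbability.meanReward {s : ℝ}
    (h : IsBigOInProbability μ (fun L => optimalReward p r v L) (fun L => L ^ s)) :
    IsBigOInProbability μ (fun L => meanReward p r v L) (fun L => L ^ (s - 1)) := by
  intro ε hε
  obtain ⟨C, hC, hev⟩ := h ε hε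
  refine ⟨C, hC, ?_⟩
  filter_upwards [hev, eventually_gt_atTop 0] with L hL hL0
  refine (measure_mono fun ω hω => ?_).trans hL
  rw [mem_ofPred_eq, ofReal_mul_rpow_sub_one hL0] at hω
  exact lt_of_not_ge fun hle => hω.not_ge (ENNReal.div_le_div_right hle _)

theorem IsBigOmegaInProbability.meanReward {s : ℝ}
    (h : IsBigOmegaInProbability μ (fun L => optimalReward p r v L) (fun L => L ^ s)) :
    IsBigOmegaInProbability μ (fun L => meanReward p r v L) (fun L => L ^ (s - 1)) := by
  intro ε hε
  obtain ⟨C, hC, hev⟩ := h ε hε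
  refine ⟨C, hC, ?_⟩
  filter_upwards [hev, eventually_gt_atTop 0] with L hL hL0
  refine (measure_mono fun ω hω => ?_).trans hL
  rw [mem_ofPred_eq, ofReal_mul_rpow_sub_one hL0] at hω
  exact lt_of_not_ge fun hle => hω.not_ge (ENNReal.div_le_div_right hle _)

/-- A measurable event of probability at least one half carries reward `c * L ^ (2 / α)`. Comparison
with its indicator needs no measurability of the supremum over paths, and `α < 2` makes the exponent
after division positive. -/
theorem IsPoissonRewardField.tendsto_lintegral_optimalReward_div [IsProbabilityMeasure μ]
    (h : IsPoissonRewardField μ lam (paretoMeasure xm α) p r) (hlam : 0 < lam) (hv : 0 < v)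
    (hxm : 0 < xm) (hα : 0 < α) (hα2 : α < 2) :
    Tendsto (fun L : ℝ => (∫⁻ ω, optimalReward p r v L ω ∂μ) / ENNReal.ofReal L) atTop (𝓝 ∞) := by
  obtain ⟨c, hc, hH⟩ := h.exists_event_le_optimalReward hlam hv hxm hα (ε := 1 / 2) (by norm_num)
  have hlim : Tendsto (fun L : ℝ => ENNReal.ofReal (c / 2 * L ^ (2 / α - 1))) atTop (𝓝 ∞) := by
    refine ENNReal.tendsto_ofReal_atTop.comp
      ((tendsto_rpow_atTop ?_).const_mul_atTop (half_pos hc))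
    rw [sub_pos, one_lt_div hα]
    exact hα2
  refine tendsto_nhds_top_mono hlim ?_
  filter_upwards [hH, eventually_gt_atTop 0] with L hL hL0
  obtain ⟨H, hHm, hHε, hle⟩ := hL
  have hHμ : ENNReal.ofReal (1 / 2) ≤ μ H := by
    have h1 := prob_compl_eq_one_sub (μ := μ) hHm.compl
    rw [compl_compl] at h1
    rw [h1, show (1 / 2 : ℝ) = 1 - 1 / 2 by norm_num, ENNReal.ofReal_sub _ (by norm_num),
      ENNReal.ofReal_one]
    exact tsub_le_tsub_left hHε _
  rw [ofReal_mul_rpow_sub_one hL0]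
  refine ENNReal.div_le_div_right ?_ _
  calc ENNReal.ofReal (c / 2 * L ^ (2 / α))
      = ENNReal.ofReal (c * L ^ (2 / α)) * ENNReal.ofReal (1 / 2) := by
        rw [← ENNReal.ofReal_mul (by positivity)]
        congr 1
        ring
    _ ≤ ENNReal.ofReal (c * L ^ (2 / α)) * μ H := by gcongr
    _ = ∫⁻ ω, H.indicator (fun _ => ENNReal.ofReal (c * L ^ (2 / α))) ω ∂μ :=
        (lintegral_indicator_const hHm _).symm
    _ ≤ ∫⁻ ω, optimalReward p r v L ω ∂μ := by
        refine lintegral_mono fun ω => ?_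
        by_cases hω : ω ∈ H
        · simpa [hω] using hle ω hω
        · simp [hω]

end

end

end RewardField

theorem mainTheorem8 {Ω : Type*} [MeasurableSpace Ω] (μ : Measure Ω) [IsProbabilityMeasure μ]
    (lam v xm α : ℝ) (hlam : 0 < lam) (hv : 0 < v) (hxm : 0 < xm) (hα : 0 < α) (hα2 : α < 2)
    (p : ℕ → Ω → ℝ × ℝ) (r : ℕ → Ω → ℝ)
    (hfield : RewardField.IsPoissonRewardField μ lam (paretoMeasure xm α) p r) :
    RewardField.optimalMeanReward μ p r v = ∞ ∧
    Tendsto (fun L : ℝ => ∫⁻ ω, RewardField.meanReward p r v L ω ∂μ) atTop (𝓝 ∞) ∧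
    RewardField.IsBigOInProbability μ (fun L => RewardField.optimalReward p r v L)
      (fun L => L ^ (2 / α)) ∧
    RewardField.IsBigOmegaInProbability μ (fun L => RewardField.optimalReward p r v L)
      (fun L => L ^ (2 / α)) ∧
    RewardField.IsBigOInProbability μ (fun L => RewardField.meanReward p r v L)
      (fun L => L ^ (2 / α - 1)) ∧
    RewardField.IsBigOmegaInProbability μ (fun L => RewardField.meanReward p r v L)
      (fun L => L ^ (2 / α - 1)) := by

  have hlim := hfield.tendsto_lintegral_optimalReward_div hlam hv hxm hα hα2
  have hO := hfield.isBigOInProbability_optimalReward hlam hv hxm hα hα2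
  have hΩ := hfield.isBigOmegaInProbability_optimalReward hlam hv hxm hα
  refine ⟨?_, ?_, hO, hΩ, hO.meanReward, hΩ.meanReward⟩
  -- The supremum over `L` dominates the limit, which is already infinite.
  · refine top_unique (le_of_tendsto hlim ?_)
    filter_upwards [eventually_gt_atTop 0] with L hL
    exact le_iSup₂ (f := fun (L : ℝ) (_ : 0 < L) =>
      (∫⁻ ω, RewardField.optimalReward p r v L ω ∂μ) / ENNReal.ofReal L) L hL
  · refine hlim.congr' ?_
    filter_upwards [eventually_gt_atTop 0] with L hL
    simp only [RewardField.meanReward, div_eq_mul_inv]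
    rw [lintegral_mul_const' _ _ (ENNReal.inv_ne_top.2 (ENNReal.ofReal_pos.2 hL).ne')]
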